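/- For a topological group $G$ let $d_{gr}G$ (resp. $d_mG$) be the minimal number of elements of a subset $A\subseteq G$ such that the subgroup (resp. the subsemigroup, i.e. the set of all products of one or more elements of $A$) generated by $A$ is dense in $G$ (the value is $\infty$ if no finite $A$ has this property). Let $G$ be a (finite-dimensional, real) abelian Lie group with identity component $G^0$ and finite component group $G/G^0$. Lists of generators below may contain repetitions, and $t,t_0,t_1\ge 0$ are integers. (a) If $G$ has a dense subgroup (resp. subsemigroup) with $t$ generators, then so does $G^0$. (b) If $G^0$ has a dense subgroup (resp. subsemigroup) with $t_0$ generators and the group $G/G^0$ can be generated by $t_1$ elements, then $G$ has a dense subgroup (resp. subsemigroup) with $\max(t_0,t_1)$ generators. (c) One has $$d_mG=\max(d_mG^0,\;d_m(G/G^0)),\qquad d_{gr}G=\max(d_{gr}G^0,\;d_{gr}(G/G^0)),$$ and, if $G$ is not the trivial group, $d_{gr}G=d_mG$, so that all four numbers coincide. (For trivial $G$ the empty set generates $G$ as a group but not as a semigroup, so $d_{gr}G=0$ and $d_mG=1$.) -/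

import Mathlib

open scoped Manifold ContDiff

/-- `d_gr G`: the minimal cardinality of a subset `A` of the topological group `G` such that the
subgroup generated by `A` is dense in `G` (`⊤` if no finite subset does this). -/
noncomputable def dGr (G : Type*) [Group G] [TopologicalSpace G] : ℕ∞ :=
  ⨅ (A : Set G) (_ : Dense (Subgroup.closure A : Set G)), A.encard

/-- `d_m G`: the minimal cardinality of a subset `A` of the topological group `G` such that the
semigroup generated by `A` (all products of one or more elements of `A`) is dense in `G`
(`⊤` if no finite subset does this). -/
noncomputable def dM (G : Type*) [Group G] [TopologicalSpace G] : ℕ∞ :=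
  ⨅ (A : Set G) (_ : Dense (Subsemigroup.closure A : Set G)), A.encard

/-- `G` has a dense subgroup with `t` generators (repetitions among the generators allowed). -/
def HasDenseSubgroup (G : Type*) [Group G] [TopologicalSpace G] (t : ℕ) : Prop :=
  ∃ a : Fin t → G, Dense (Subgroup.closure (Set.range a) : Set G)

/-- `G` has a dense subsemigroup with `t` generators (repetitions among the generators allowed). -/
def HasDenseSubsemigroup (G : Type*) [Group G] [TopologicalSpace G] (t : ℕ) : Prop :=
  ∃ a : Fin t → G, Dense (Subsemigroup.closure (Set.range a) : Set G)

/-- The abstract group `Q` can be generated by `t` elements. -/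
def GeneratedBy (Q : Type*) [Group Q] (t : ℕ) : Prop :=
  ∃ a : Fin t → Q, Subgroup.closure (Set.range a) = ⊤

/-!
The statement splits into two facts about `G`, neither of which needs the classification of abelian
Lie groups.

*Divisibility of the identity component.* Let `n ≠ 0`. The power map `x ↦ x ^ n` has derivative
`n • id` at `1`, so by the inverse function theorem it is open at `1` (`map_pow_nhds_one`). The
image of `G⁰` is therefore an open, hence clopen, subgroup, and every element of `G⁰` is an `n`-th
power of an element of `G⁰` (`exists_pow_eq_of_mem_connectedComponentOfOne`). Take for `n` the
order of `G ⧸ G⁰`. Then `x ↦ x ^ n` is a continuous surjective homomorphism `G → G⁰` and carries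
generators of dense sub(semi)groups of `G` to such generators of `G⁰`. Conversely, given elements
`g i` of `G⁰` and `q i` of `G ⧸ G⁰`, a representative of `q i` can be multiplied by an element of
`G⁰` so that its `n`-th power becomes `g i` (`Subgroup.exists_lift_pow_index_eq`). The resulting
elements generate a sub(semi)group that contains all `g i` and meets every coset, so it is dense
when the `g i` generate a dense sub(semi)group of `G⁰` and the `q i` generate `G ⧸ G⁰`.

*From subgroups to subsemigroups.* Let `a i`, with `i` in a nonempty finite set `ι`, generate a
dense subgroup. Unless `G` is discrete (and then finite), every neighbourhood of `1` contains
`∏ i, a i ^ v i` for some nonzero `v : ι → ℤ` (`exists_ne_zero_prod_zpow_mem`). By the pigeonhole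
principle there are signs `s i` and an index `j` such that arbitrarily small neighbourhoods admit
such a `v` with all `s i * v i ≥ 0` and `s j * v j > 0`. An invertible integral change of generators
then makes all exponents positive (`exists_closure_range_eq_and_forall_pos`). If products
`∏ i, b i ^ w i` with all `w i ≥ 1` come arbitrarily close to `1`, then dividing them by `b i` shows
that `(b i)⁻¹` lies in the closure of the semigroup generated by the `b i`, so this closure is
the whole group (`dense_subsemigroup_closure_range`).
-/

section DenseGenerators

open Filter Set
open scoped Topology

/-! ### The power map of a Lie group near the identity -/

section LiePow

variable {E : Type*} [NormedAddCommGroup E] [NormedSpace ℝ E]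
  {H : Type*} [TopologicalSpace H] {I : ModelWithCorners ℝ E H}
  {G : Type*} [Group G] [TopologicalSpace G] [ChartedSpace H G] [LieGroup I ∞ G]

/-- The multiplication `G × G → G` has derivative `(v, w) ↦ v + w` at the identity, so the
derivative of `x ↦ x ^ n` at the identity is `n • id`. -/
theorem hasMFDerivAt_pow_one (n : ℕ) :
    HasMFDerivAt I I (fun x : G ↦ x ^ n) 1
      ((n : ℝ) • ContinuousLinearMap.id ℝ E : E →L[ℝ] E) := by
  induction n with
  | zero =>
    have h := hasMFDerivAt_const (I := I) (I' := I) (1 : G) (1 : G)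
    have h0 : ((0 : ℕ) : ℝ) • ContinuousLinearMap.id ℝ E = 0 := by simp
    rw [h0]
    exact h.congr_of_eventuallyEq (.of_forall fun x ↦ pow_zero x)
  | succ n ih =>
    have hmul : MDifferentiableAt (I.prod I) I (fun p : G × G ↦ p.1 * p.2) ((1 : G) ^ n, 1) :=
      (contMDiff_mul I ∞).mdifferentiable (by simp) _
    have h := HasMFDerivAt.comp (f := fun x : G ↦ (x ^ n, x)) (1 : G) hmul.hasMFDerivAt
      (ih.prodMk (hasMFDerivAt_id (I := I) (1 : G)))
    have h' := h.congr_of_eventuallyEq (f₁ := fun x : G ↦ x ^ (n + 1))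
      (.of_forall fun x ↦ pow_succ x n)
    have hl : mfderiv I I (fun z : G ↦ z * 1) (1 ^ n) = ContinuousLinearMap.id ℝ E :=
      ((hasMFDerivAt_id _).congr_of_eventuallyEq (.of_forall mul_one)).mfderiv
    have hr : mfderiv I I (fun z : G ↦ 1 ^ n * z) 1 = ContinuousLinearMap.id ℝ E :=
      ((hasMFDerivAt_id _).congr_of_eventuallyEq (.of_forall fun z ↦ by simp)).mfderiv
    refine (congrArg (HasMFDerivAt I I (fun x : G ↦ x ^ (n + 1)) 1) ?_).mpr h'
    ext v
    have hv := mfderiv_prod_eq_add_apply (v := ((n : ℝ) • v, v)) hmul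
    rw [hl, hr] at hv
    refine Eq.trans ?_ hv.symm
    change ((n + 1 : ℕ) : ℝ) • v = (n : ℝ) • v + v
    rw [Nat.cast_succ, add_smul, one_smul]

/-- The power map `x ↦ x ^ n` with `n ≠ 0` is open at the identity, by the inverse function theorem
in a chart. -/
theorem map_pow_nhds_one [CompleteSpace E] [I.Boundaryless] {n : ℕ} (hn : n ≠ 0) :
    map (fun x : G ↦ x ^ n) (𝓝 1) = 𝓝 1 := by
  set φ := extChartAt I (1 : G)
  set p : G → G := fun x ↦ x ^ n
  have hp1 : p 1 = 1 := one_pow n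
  have hd := hasMFDerivAt_pow_one (I := I) (G := G) n
  have hs : ContMDiffAt I I ∞ p 1 := (contMDiff_pow (I := I) (n := ∞) n) 1
  have hF : ContDiffAt ℝ ∞ (writtenInExtChartAt I I 1 p) (φ 1) := by
    have := (contMDiffAt_iff.1 hs).2
    rwa [I.range_eq_univ, contDiffWithinAt_univ] at this
  have hF' : HasFDerivAt (writtenInExtChartAt I I 1 p) ((n : ℝ) • ContinuousLinearMap.id ℝ E)
      (φ 1) := by
    have : HasFDerivWithinAt (writtenInExtChartAt I I 1 p) ((n : ℝ) • ContinuousLinearMap.id ℝ E)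
      (range I) (φ 1) := hd.2
    rwa [I.range_eq_univ, hasFDerivWithinAt_univ] at this
  have hst := hF.hasStrictFDerivAt' hF' (by simp)
  have hsurj : ((n : ℝ) • ContinuousLinearMap.id ℝ E).range = ⊤ := by
    rw [LinearMap.range_eq_top]
    intro v
    exact ⟨(n : ℝ)⁻¹ • v, by simp [smul_smul, hn]⟩
  have hmap := hst.map_nhds_eq_of_surj hsurj
  have hφ : map φ (𝓝 1) = 𝓝 (φ 1) := map_extChartAt_nhds_of_boundaryless (1 : G)
  have hwr : writtenInExtChartAt I I 1 p = φ ∘ p ∘ φ.symm := by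
    simp [writtenInExtChartAt, hp1, φ]
  have hleft : ∀ᶠ x in 𝓝 (1 : G), φ.symm (φ x) = x :=
    eventually_of_mem (extChartAt_source_mem_nhds (I := I) 1) fun x hx ↦ φ.left_inv hx
  have hφ1 : φ.symm (φ 1) = 1 := hleft.self_of_nhds
  have hpt : Tendsto p (𝓝 1) (𝓝 1) := by
    simpa [hp1] using hs.continuousAt.tendsto
  have key : map φ (map p (𝓝 1)) = map φ (𝓝 1) := by
    have h1 : map (φ ∘ p ∘ φ.symm) (map φ (𝓝 1)) = map φ (map p (𝓝 1)) := by
      rw [map_map, map_map]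
      refine map_congr ?_
      filter_upwards [hleft] with x hx
      simp [hx]
    rw [← h1, hφ, ← hwr, hmap, hwr]
    simp [hφ1, hp1]
  -- The chart is injective near `1`, so it can be cancelled on filters below `𝓝 1`.
  have key2 := congrArg (map φ.symm) key
  have hid (F : Filter G) (hF : F ≤ 𝓝 1) : map φ.symm (map φ F) = F := by
    rw [map_map, map_congr (show φ.symm ∘ φ =ᶠ[F] id from hF hleft), map_id]
  rwa [hid _ hpt, hid _ le_rfl] at key2

end LiePow

/-! ### The identity component -/

section IdentityComponent

variable {E : Type*} [NormedAddCommGroup E] [NormedSpace ℝ E]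
  {H : Type*} [TopologicalSpace H]

theorem isOpen_connectedComponentOfOne (I : ModelWithCorners ℝ E H) [I.Boundaryless]
    (G : Type*) [Group G] [TopologicalSpace G] [IsTopologicalGroup G] [ChartedSpace H G] :
    IsOpen (Subgroup.connectedComponentOfOne G : Set G) := by
  have : LocallyConnectedSpace H := I.toHomeomorph.locallyConnectedSpace
  have : LocallyConnectedSpace G := ChartedSpace.locallyConnectedSpace H G
  exact isOpen_connectedComponent

/-- The identity component of an abelian Lie group is divisible. -/
theorem exists_pow_eq_of_mem_connectedComponentOfOne [CompleteSpace E]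
    (I : ModelWithCorners ℝ E H) [I.Boundaryless] {G : Type*} [CommGroup G] [TopologicalSpace G]
    [IsTopologicalGroup G] [ChartedSpace H G] [LieGroup I ∞ G] {n : ℕ} (hn : n ≠ 0)
    {x : G} (hx : x ∈ Subgroup.connectedComponentOfOne G) :
    ∃ y ∈ Subgroup.connectedComponentOfOne G, y ^ n = x := by
  set K := (Subgroup.connectedComponentOfOne G).map (powMonoidHom n)
  have hK : (K : Set G) ∈ 𝓝 1 := by
    rw [← map_pow_nhds_one (I := I) hn]
    exact image_mem_map ((isOpen_connectedComponentOfOne I G).mem_nhds (one_mem _))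
  have hKo : IsOpen (K : Set G) := K.isOpen_of_mem_nhds hK
  have hKc : IsClopen (K : Set G) := ⟨K.isClosed_of_isOpen hKo, hKo⟩
  exact hKc.connectedComponent_subset K.one_mem hx

theorem finite_of_discreteTopology_of_finite_quotient {G : Type*} [Group G] [TopologicalSpace G]
    [IsTopologicalGroup G] [DiscreteTopology G]
    [Finite (G ⧸ Subgroup.connectedComponentOfOne G)] : Finite G := by
  refine Finite.of_injective (QuotientGroup.mk : G → G ⧸ Subgroup.connectedComponentOfOne G)
    fun x y hxy ↦ ?_
  have h : x⁻¹ * y ∈ connectedComponent (1 : G) := QuotientGroup.eq.1 hxy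
  rw [connectedComponent_eq_singleton, mem_singleton_iff, inv_mul_eq_one] at h
  exact h

end IdentityComponent

/-! ### Numbers of topological generators -/

/-- A finite family can be lengthened by repeating its last member. -/
theorem exists_range_eq_of_le {α : Type*} {s t : ℕ} (hs : s ≠ 0) (hst : s ≤ t) (a : Fin s → α) :
    ∃ b : Fin t → α, range b = range a := by
  obtain ⟨r, rfl⟩ := Nat.exists_eq_succ_of_ne_zero hs
  refine ⟨fun i ↦ a ⟨min i r, by omega⟩, Subset.antisymm ?_ ?_⟩
  · rintro _ ⟨i, rfl⟩
    exact mem_range_self _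
  · rintro _ ⟨i, rfl⟩
    exact ⟨⟨i, by omega⟩, congrArg a (Fin.ext (min_eq_left (Nat.le_of_lt_succ i.2)))⟩

/-- A list of generators of a group can be lengthened; the empty list is lengthened by `1`. -/
theorem exists_closure_range_eq_of_le {G : Type*} [Group G] {s t : ℕ} (hst : s ≤ t)
    (a : Fin s → G) :
    ∃ b : Fin t → G, Subgroup.closure (range b) = Subgroup.closure (range a) := by
  obtain rfl | hs := eq_or_ne s 0
  · refine ⟨fun _ ↦ 1, ?_⟩
    rw [range_eq_empty a, Subgroup.closure_empty, eq_bot_iff, Subgroup.closure_le]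
    rintro _ ⟨i, rfl⟩
    exact one_mem _
  · obtain ⟨b, hb⟩ := exists_range_eq_of_le hs hst a
    exact ⟨b, by rw [hb]⟩

theorem GeneratedBy.mono {G : Type*} [Group G] {s t : ℕ} (h : GeneratedBy G s) (hst : s ≤ t) :
    GeneratedBy G t := by
  obtain ⟨a, ha⟩ := h
  obtain ⟨b, hb⟩ := exists_closure_range_eq_of_le hst a
  exact ⟨b, hb.trans ha⟩

theorem exists_range_eq_of_encard_le {α : Type*} {A : Set α} {t : ℕ} (h : A.encard ≤ t) :
    ∃ s ≤ t, ∃ a : Fin s → α, range a = A := by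
  have hA : A.Finite := finite_of_encard_le_coe h
  obtain ⟨s, a, hinj, rfl⟩ := hA.fin_param
  refine ⟨s, ?_, a, rfl⟩
  rw [← image_univ, hinj.encard_image] at h
  simpa using h

theorem encard_range_fin_le {α : Type*} {t : ℕ} (a : Fin t → α) : (range a).encard ≤ t := by
  rw [← image_univ]
  exact (encard_image_le a univ).trans (by simp)

theorem exists_encard_le_of_iInf_le {α : Type*} {p : Set α → Prop} {t : ℕ}
    (h : ⨅ (A : Set α) (_ : p A), A.encard ≤ t) : ∃ A, p A ∧ A.encard ≤ t := by
  have h' : ⨅ (A : Set α) (_ : p A), A.encard < (t + 1 : ℕ) :=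
    h.trans_lt (by exact_mod_cast t.lt_succ_self)
  simp only [iInf_lt_iff] at h'
  obtain ⟨A, hA, hlt⟩ := h'
  exact ⟨A, hA, ENat.lt_add_one_iff (by simp) |>.1 (by exact_mod_cast hlt)⟩

theorem ENat.eq_of_forall_le_natCast_iff {m n : ℕ∞} (h : ∀ t : ℕ, m ≤ t ↔ n ≤ t) : m = n := by
  apply le_antisymm
  · cases n using ENat.recTopCoe with
    | top => exact le_top
    | coe t => exact (h t).2 le_rfl
  · cases m using ENat.recTopCoe with
    | top => exact le_top
    | coe t => exact (h t).1 le_rfl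

section Generators

variable {G K : Type*} [Group G] [TopologicalSpace G] [Group K] [TopologicalSpace K]

theorem HasDenseSubgroup.map {t : ℕ} (h : HasDenseSubgroup G t) (f : G →* K)
    (hf : Continuous f) (hs : Function.Surjective f) : HasDenseSubgroup K t := by
  obtain ⟨a, ha⟩ := h
  refine ⟨f ∘ a, ?_⟩
  rw [range_comp, ← MonoidHom.map_closure]
  exact hs.denseRange.dense_image hf ha

theorem HasDenseSubsemigroup.map {t : ℕ} (h : HasDenseSubsemigroup G t) (f : G →* K)
    (hf : Continuous f) (hs : Function.Surjective f) : HasDenseSubsemigroup K t := by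
  obtain ⟨a, ha⟩ := h
  refine ⟨f ∘ a, ?_⟩
  have hcl : Subsemigroup.closure (range (f ∘ a)) =
      (Subsemigroup.closure (range a)).map (f : G →ₙ* K) := by
    rw [MulHom.map_mclosure, range_comp]
    rfl
  rw [hcl]
  exact hs.denseRange.dense_image hf ha

theorem HasDenseSubsemigroup.hasDenseSubgroup {t : ℕ} (h : HasDenseSubsemigroup G t) :
    HasDenseSubgroup G t := by
  obtain ⟨a, ha⟩ := h
  refine ⟨a, ha.mono ?_⟩
  exact (Subsemigroup.closure_le (S := (Subgroup.closure (range a)).toSubsemigroup)).2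
    Subgroup.subset_closure

theorem HasDenseSubsemigroup.ne_zero {t : ℕ} (h : HasDenseSubsemigroup G t) : t ≠ 0 := by
  rintro rfl
  obtain ⟨a, ha⟩ := h
  rw [range_eq_empty, Subsemigroup.closure_empty, Subsemigroup.coe_bot] at ha
  exact ha.nonempty.ne_empty rfl

theorem HasDenseSubsemigroup.mono {s t : ℕ} (h : HasDenseSubsemigroup G s) (hst : s ≤ t) :
    HasDenseSubsemigroup G t := by
  obtain ⟨a, ha⟩ := id h
  obtain ⟨b, hb⟩ := exists_range_eq_of_le h.ne_zero hst a
  exact ⟨b, hb ▸ ha⟩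

theorem HasDenseSubgroup.mono {s t : ℕ} (h : HasDenseSubgroup G s) (hst : s ≤ t) :
    HasDenseSubgroup G t := by
  obtain ⟨a, ha⟩ := h
  obtain ⟨b, hb⟩ := exists_closure_range_eq_of_le hst a
  exact ⟨b, hb ▸ ha⟩

theorem generatedBy_iff_hasDenseSubgroup [DiscreteTopology G] {t : ℕ} :
    GeneratedBy G t ↔ HasDenseSubgroup G t := by
  simp [GeneratedBy, HasDenseSubgroup, dense_discrete, Subgroup.coe_eq_univ]

theorem dGr_le_iff {t : ℕ} : dGr G ≤ t ↔ HasDenseSubgroup G t := by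
  refine ⟨fun h ↦ ?_, fun ⟨a, ha⟩ ↦
    le_trans (iInf₂_le (range a) ha) (encard_range_fin_le a)⟩
  obtain ⟨A, hA, hAt⟩ := exists_encard_le_of_iInf_le h
  obtain ⟨s, hs, a, rfl⟩ := exists_range_eq_of_encard_le hAt
  exact HasDenseSubgroup.mono ⟨a, hA⟩ hs

theorem dM_le_iff {t : ℕ} : dM G ≤ t ↔ HasDenseSubsemigroup G t := by
  refine ⟨fun h ↦ ?_, fun ⟨a, ha⟩ ↦
    le_trans (iInf₂_le (range a) ha) (encard_range_fin_le a)⟩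
  obtain ⟨A, hA, hAt⟩ := exists_encard_le_of_iInf_le h
  obtain ⟨s, hs, a, rfl⟩ := exists_range_eq_of_encard_le hAt
  exact HasDenseSubsemigroup.mono ⟨a, hA⟩ hs

theorem HasDenseSubgroup.ne_zero [T1Space G] [Nontrivial G] {t : ℕ} (h : HasDenseSubgroup G t) :
    t ≠ 0 := by
  rintro rfl
  obtain ⟨a, ha⟩ := h
  rw [range_eq_empty, Subgroup.closure_empty, Subgroup.coe_bot, dense_iff_closure_eq,
    closure_singleton] at ha
  exact not_subsingleton G (subsingleton_univ_iff.1 (ha ▸ subsingleton_singleton))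

end Generators

/-! ### Passing between a group and a divisible subgroup of finite index -/

theorem Subsemigroup.pow_mem_of_ne_zero {M : Type*} [Monoid M] (S : Subsemigroup M) {x : M}
    (hx : x ∈ S) {n : ℕ} (hn : n ≠ 0) : x ^ n ∈ S := by
  induction n, Nat.one_le_iff_ne_zero.2 hn using Nat.le_induction with
  | base => simpa using hx
  | succ n hn ih => rw [pow_succ]; exact mul_mem (ih (by omega)) hx

theorem Subsemigroup.closure_range_eq_top_of_finite {ι Q : Type*} [Nonempty ι] [Group Q] [Finite Q]
    {q : ι → Q} (hq : Subgroup.closure (range q) = ⊤) : Subsemigroup.closure (range q) = ⊤ := by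
  refine (Subsemigroup.eq_top_iff' _).2 fun x ↦ ?_
  have hx : x ∈ Submonoid.closure (range q) := by
    rw [← Subgroup.closure_toSubmonoid_of_finite, hq]
    trivial
  induction hx using Submonoid.closure_induction with
  | mem x hx => exact Subsemigroup.subset_closure hx
  | one =>
    obtain ⟨i⟩ := ‹Nonempty ι›
    rw [← pow_orderOf_eq_one (q i)]
    exact Subsemigroup.pow_mem_of_ne_zero _ (Subsemigroup.subset_closure (mem_range_self i))
      (orderOf_pos _).ne'
  | mul x y _ _ hx hy => exact mul_mem hx hy

section Extension

variable {G : Type*} [CommGroup G]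

/-- The homomorphism `x ↦ x ^ n` from an abelian group to a subgroup `N` of index `n`; it is trivial
if the index is infinite, since `N.index = 0` then. -/
noncomputable def Subgroup.powIndexHom (N : Subgroup G) : G →* N :=
  (powMonoidHom N.index).codRestrict N fun x ↦ N.pow_index_mem x

theorem Subgroup.continuous_powIndexHom [TopologicalSpace G] [IsTopologicalGroup G]
    (N : Subgroup G) : Continuous N.powIndexHom :=
  (continuous_pow N.index).subtype_mk _

theorem Subgroup.powIndexHom_surjective {N : Subgroup G}
    (hdiv : ∀ x ∈ N, ∃ y ∈ N, y ^ N.index = x) :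
    Function.Surjective N.powIndexHom := fun x ↦
  let ⟨y, _, hy⟩ := hdiv x x.2
  ⟨y, Subtype.ext hy⟩

/-- If `N` is divisible by its index `n`, then every element of `G ⧸ N` has a representative whose
`n`-th power is a prescribed element of `N`. -/
theorem Subgroup.exists_lift_pow_index_eq {ι : Type*} {N : Subgroup G}
    (hdiv : ∀ x ∈ N, ∃ y ∈ N, y ^ N.index = x) (g : ι → N) (q : ι → G ⧸ N) :
    ∃ x : ι → G, (∀ i, (x i : G ⧸ N) = q i) ∧ ∀ i, x i ^ N.index = g i := by
  have (i : ι) : ∃ x : G, (x : G ⧸ N) = q i ∧ x ^ N.index = g i := by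
    obtain ⟨h, hh⟩ := QuotientGroup.mk_surjective (q i)
    obtain ⟨y, hyN, hy⟩ := hdiv _ (mul_mem (inv_mem (N.pow_index_mem h)) (g i).2)
    refine ⟨h * y, ?_, by rw [mul_pow, hy, mul_inv_cancel_left]⟩
    rw [QuotientGroup.mk_mul_of_mem _ hyN, hh]
  choose x hx hx' using this
  exact ⟨x, hx, hx'⟩

variable [TopologicalSpace G] [IsTopologicalGroup G]

/-- A subset of `G` that is closed under multiplication, dense on a subgroup `N` and meets every
coset of `N` is dense. -/
theorem dense_of_dense_preimage_of_forall_exists_mk_eq {N : Subgroup G} {S : Set G}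
    (hmul : ∀ x ∈ S, ∀ y ∈ S, x * y ∈ S)
    (hN : Dense ((↑) ⁻¹' S : Set N)) (hq : ∀ q : G ⧸ N, ∃ x ∈ S, (x : G ⧸ N) = q) :
    Dense S := by
  have hNS : (N : Set G) ⊆ closure S := fun x hx ↦ by
    have := hN ⟨x, hx⟩
    rw [closure_subtype] at this
    exact closure_mono (image_preimage_subset _ _) this
  intro x
  obtain ⟨s, hs, hsx⟩ := hq x
  have h1 : s⁻¹ * x ∈ closure S := hNS (QuotientGroup.eq.1 hsx)
  have h2 : s * (s⁻¹ * x) ∈ closure S :=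
    map_mem_closure (continuous_const_mul s) h1 fun y hy ↦ hmul s hs y hy
  simpa using h2

theorem HasDenseSubgroup.of_quotient {N : Subgroup G}
    (hdiv : ∀ x ∈ N, ∃ y ∈ N, y ^ N.index = x) {t₀ t₁ : ℕ} (h₀ : HasDenseSubgroup N t₀)
    (h₁ : GeneratedBy (G ⧸ N) t₁) : HasDenseSubgroup G (max t₀ t₁) := by
  obtain ⟨g, hg⟩ := h₀.mono (le_max_left t₀ t₁)
  obtain ⟨q, hq⟩ := h₁.mono (le_max_right t₀ t₁)
  obtain ⟨x, hxq, hxg⟩ := Subgroup.exists_lift_pow_index_eq hdiv g q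
  refine ⟨x, dense_of_dense_preimage_of_forall_exists_mk_eq (N := N)
    (fun _ h _ h' ↦ mul_mem h h') ?_ ?_⟩
  · refine hg.mono ?_
    refine (Subgroup.closure_le (K := (Subgroup.closure (range x)).comap N.subtype)).2 ?_
    rintro _ ⟨i, rfl⟩
    change (g i : G) ∈ Subgroup.closure (range x)
    rw [← hxg]
    exact pow_mem (Subgroup.subset_closure (mem_range_self i)) _
  · intro p
    have hp : p ∈ (Subgroup.closure (range x)).map (QuotientGroup.mk' N) := by
      rw [MonoidHom.map_closure, ← range_comp]
      have : QuotientGroup.mk' N ∘ x = q := funext hxq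
      rw [this, hq]
      trivial
    exact hp

theorem HasDenseSubsemigroup.of_quotient {N : Subgroup G} [Finite (G ⧸ N)]
    (hdiv : ∀ x ∈ N, ∃ y ∈ N, y ^ N.index = x) {t₀ t₁ : ℕ} (h₀ : HasDenseSubsemigroup N t₀)
    (h₁ : GeneratedBy (G ⧸ N) t₁) : HasDenseSubsemigroup G (max t₀ t₁) := by
  have ht : Nonempty (Fin (max t₀ t₁)) :=
    Fin.pos_iff_nonempty.1 (lt_max_of_lt_left (Nat.pos_of_ne_zero h₀.ne_zero))
  obtain ⟨g, hg⟩ := h₀.mono (le_max_left t₀ t₁)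
  obtain ⟨q, hq⟩ := h₁.mono (le_max_right t₀ t₁)
  obtain ⟨x, hxq, hxg⟩ := Subgroup.exists_lift_pow_index_eq hdiv g q
  refine ⟨x, dense_of_dense_preimage_of_forall_exists_mk_eq (N := N)
    (fun _ h _ h' ↦ mul_mem h h') ?_ ?_⟩
  · refine hg.mono ?_
    refine (Subsemigroup.closure_le
      (S := (Subsemigroup.closure (range x)).comap N.subtype.toMulHom)).2 ?_
    rintro _ ⟨i, rfl⟩
    change (g i : G) ∈ Subsemigroup.closure (range x)
    rw [← hxg]
    exact Subsemigroup.pow_mem_of_ne_zero _ (Subsemigroup.subset_closure (mem_range_self i))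
      Subgroup.index_ne_zero_of_finite
  · intro p
    have hp : p ∈ (Subsemigroup.closure (range x)).map (QuotientGroup.mk' N).toMulHom := by
      rw [MulHom.map_mclosure, ← range_comp]
      have : (QuotientGroup.mk' N).toMulHom ∘ x = q := funext hxq
      rw [this, Subsemigroup.closure_range_eq_top_of_finite hq]
      trivial
    exact hp

end Extension

/-! ### From dense subgroups to dense subsemigroups -/

section PositiveGenerators

variable {ι G : Type*} [CommGroup G]

/-- The families `c` and `b`, where `b i = c i` for `i ≠ j` and `b j = c j * ∏ i ≠ j, (c i)⁻¹`,
generate the same subgroup, since `c j` is the product of all `b i`. -/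
theorem Subgroup.closure_range_update_div_prod [Fintype ι] [DecidableEq ι] (c : ι → G) (j : ι) :
    Subgroup.closure (range (Function.update c j (c j * ∏ i ∈ Finset.univ.erase j, (c i)⁻¹))) =
      Subgroup.closure (range c) := by
  set b := Function.update c j (c j * ∏ i ∈ Finset.univ.erase j, (c i)⁻¹) with hb
  have hne : ∀ i, i ≠ j → b i = c i := fun i hi ↦ Function.update_of_ne hi _ _
  have hj : b j = c j * ∏ i ∈ Finset.univ.erase j, (c i)⁻¹ := Function.update_self ..
  have hcb : c j = b j * ∏ i ∈ Finset.univ.erase j, b i := by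
    rw [hj, Finset.prod_congr rfl fun i hi ↦ hne i (Finset.ne_of_mem_erase hi),
      Finset.prod_inv_distrib, inv_mul_cancel_right]
  apply le_antisymm <;> rw [Subgroup.closure_le] <;> rintro _ ⟨i, rfl⟩ <;>
    obtain rfl | hi := eq_or_ne i j
  · rw [hj]
    exact mul_mem (Subgroup.subset_closure (mem_range_self _))
      (prod_mem fun k _ ↦ inv_mem (Subgroup.subset_closure (mem_range_self _)))
  · rw [hne i hi]
    exact Subgroup.subset_closure (mem_range_self _)
  · rw [hcb]
    exact mul_mem (Subgroup.subset_closure (mem_range_self _))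
      (prod_mem fun k _ ↦ Subgroup.subset_closure (mem_range_self _))
  · rw [← hne i hi]
    exact Subgroup.subset_closure (mem_range_self _)

theorem Subgroup.closure_range_zpow_units (a : ι → G) (s : ι → ℤˣ) :
    Subgroup.closure (range fun i ↦ a i ^ (s i : ℤ)) = Subgroup.closure (range a) := by
  apply le_antisymm <;> rw [Subgroup.closure_le] <;> rintro _ ⟨i, rfl⟩
  · exact zpow_mem (Subgroup.subset_closure (mem_range_self _)) _
  · have h : a i = (a i ^ (s i : ℤ)) ^ (s i : ℤ) := by
      rw [← zpow_mul, Int.units_coe_mul_self, zpow_one]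
    rw [h]
    exact zpow_mem (Subgroup.subset_closure (mem_range_self (f := fun i ↦ a i ^ (s i : ℤ)) i)) _

/-- Each nonzero integer vector follows one of finitely many patterns `(j, s)`: after the
coordinates are multiplied by the signs `s`, all are nonnegative and the one with index
`j` is positive. -/
theorem exists_sign_pattern {v : ι → ℤ} (hv : v ≠ 0) :
    ∃ p : ι × (ι → ℤˣ), (∀ i, 0 ≤ (p.2 i : ℤ) * v i) ∧ 0 < (p.2 p.1 : ℤ) * v p.1 := by
  obtain ⟨j, hj⟩ := Function.ne_iff.1 hv
  have hs (z : ℤ) : ∃ s : ℤˣ, (s : ℤ) * z = |z| := by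
    obtain h | h := le_total 0 z
    · exact ⟨1, by simp [abs_of_nonneg h]⟩
    · exact ⟨-1, by simp [abs_of_nonpos h]⟩
  choose s hs using hs
  exact ⟨(j, fun i ↦ s (v i)), fun i ↦ by simp [hs], by simpa [hs] using hj⟩

/-- The exponents with respect to the generators of `Subgroup.closure_range_update_div_prod` arise
by adding the `j`-th exponent to all the others. -/
theorem prod_zpow_eq_prod_update_pow [Fintype ι] [DecidableEq ι] (c : ι → G) (j : ι) (u : ι → ℤ) :
    ∏ i, c i ^ u i =
      ∏ i, Function.update c j (c j * ∏ i ∈ Finset.univ.erase j, (c i)⁻¹) i ^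
        Function.update (fun i ↦ u i + u j) j (u j) i := by
  rw [← Finset.mul_prod_erase _ _ (Finset.mem_univ j),
    ← Finset.mul_prod_erase Finset.univ (fun i ↦ Function.update c j _ i ^ _) (Finset.mem_univ j)]
  have hrest : ∏ i ∈ Finset.univ.erase j,
      Function.update c j (c j * ∏ i ∈ Finset.univ.erase j, (c i)⁻¹) i ^
        Function.update (fun i ↦ u i + u j) j (u j) i =
      ∏ i ∈ Finset.univ.erase j, c i ^ u i * c i ^ u j :=
    Finset.prod_congr rfl fun i hi ↦ by
      rw [Function.update_of_ne (Finset.ne_of_mem_erase hi),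
        Function.update_of_ne (Finset.ne_of_mem_erase hi), zpow_add]
  rw [hrest, Function.update_self, Function.update_self, Finset.prod_mul_distrib,
    Finset.prod_zpow, mul_zpow, Finset.prod_inv_distrib, inv_zpow, mul_assoc,
    mul_comm (∏ i ∈ Finset.univ.erase j, c i ^ u i), inv_mul_cancel_left]

variable [TopologicalSpace G]

/-- If products with nonzero integral exponent vectors come arbitrarily close to `1`, then the
subgroup generated by `a` has a generating family `b` with the same index set such that products of
the `b i` with only positive exponents come arbitrarily close to `1`. -/
theorem exists_closure_range_eq_and_forall_pos [Fintype ι] (a : ι → G)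
    (h : ∀ U ∈ 𝓝 (1 : G), ∃ v : ι → ℤ, v ≠ 0 ∧ ∏ i, a i ^ v i ∈ U) :
    ∃ b : ι → G, Subgroup.closure (range b) = Subgroup.closure (range a) ∧
      ∀ U ∈ 𝓝 (1 : G), ∃ w : ι → ℕ, (∀ i, w i ≠ 0) ∧ ∏ i, b i ^ w i ∈ U := by
  classical
  have h1 : ∃ᶠ v in comap (fun v : ι → ℤ ↦ ∏ i, a i ^ v i) (𝓝 1),
      ∃ p : ι × (ι → ℤˣ), (∀ i, 0 ≤ (p.2 i : ℤ) * v i) ∧ 0 < (p.2 p.1 : ℤ) * v p.1 := by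
    rw [frequently_iff]
    rintro _ ⟨U, hU, hUs⟩
    obtain ⟨v, hv, hvU⟩ := h U hU
    exact ⟨v, hUs hvU, exists_sign_pattern hv⟩
  -- There are finitely many patterns, so one of them occurs in every neighbourhood.
  obtain ⟨⟨j, s⟩, h2⟩ := frequently_exists.1 h1
  refine ⟨_, (Subgroup.closure_range_update_div_prod (fun i ↦ a i ^ (s i : ℤ)) j).trans
    (Subgroup.closure_range_zpow_units a s), fun U hU ↦ ?_⟩
  obtain ⟨v, ⟨hv0, hvj⟩, hvU⟩ := (h2.and_eventually (preimage_mem_comap hU)).exists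
  set u : ι → ℤ := fun i ↦ s i * v i with hu
  have hav : ∏ i, a i ^ v i = ∏ i, (a i ^ (s i : ℤ)) ^ u i :=
    Finset.prod_congr rfl fun i _ ↦ by
      rw [← zpow_mul, hu, ← mul_assoc, Int.units_coe_mul_self, one_mul]
  have hpos (i : ι) : 0 < Function.update (fun i ↦ u i + u j) j (u j) i := by
    obtain rfl | hi := eq_or_ne i j
    · simpa using hvj
    · rw [Function.update_of_ne hi]
      exact add_pos_of_nonneg_of_pos (hv0 i) hvj
  refine ⟨fun i ↦ (Function.update (fun i ↦ u i + u j) j (u j) i).toNat, fun i ↦ ?_, ?_⟩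
  · exact (Int.pos_iff_toNat_pos.1 (hpos i)).ne'
  · change ∏ i, a i ^ v i ∈ U at hvU
    rw [hav, prod_zpow_eq_prod_update_pow _ j] at hvU
    convert hvU using 3 with i
    rw [← zpow_natCast, Int.toNat_of_nonneg (hpos i).le]

/-- If products of the `b i` with positive exponents come arbitrarily close to `1`, then the closure
of the semigroup generated by the `b i` contains the inverses of the `b i`, so it is a group. -/
theorem dense_subsemigroup_closure_range [IsTopologicalGroup G] [Fintype ι] [Nonempty ι] {b : ι → G}
    (hd : Dense (Subgroup.closure (range b) : Set G))
    (h : ∀ U ∈ 𝓝 (1 : G), ∃ w : ι → ℕ, (∀ i, w i ≠ 0) ∧ ∏ i, b i ^ w i ∈ U) :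
    Dense (Subsemigroup.closure (range b) : Set G) := by
  classical
  set S := Subsemigroup.closure (range b)
  have hbS (i : ι) : b i ∈ S := Subsemigroup.subset_closure (mem_range_self i)
  have hprod (w : ι → ℕ) (hw : ∀ i, w i ≠ 0) : ∏ i, b i ^ w i ∈ S :=
    Finset.prod_induction_nonempty _ (· ∈ S) (fun _ _ ↦ mul_mem) Finset.univ_nonempty
      fun i _ ↦ S.pow_mem_of_ne_zero (hbS i) (hw i)
  set T := S.topologicalClosure
  have h1 : (1 : G) ∈ T := mem_closure_iff_nhds.2 fun U hU ↦
    let ⟨w, hw, hwU⟩ := h U hU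
    ⟨_, hwU, hprod w hw⟩
  have hmono (x : G) (hx : x ∈ Submonoid.closure (range b)) : x ∈ T := by
    induction hx using Submonoid.closure_induction with
    | mem x hx => exact S.le_topologicalClosure (Subsemigroup.subset_closure hx)
    | one => exact h1
    | mul x y _ _ hx hy => exact mul_mem hx hy
  have hinv (i : ι) : (b i)⁻¹ ∈ T := by
    have hcl : IsClosed (T : Set G) := S.isClosed_topologicalClosure
    change _ ∈ (T : Set G)
    rw [← hcl.closure_eq, mem_closure_iff_nhds]
    intro U hU
    have hU' : (fun x ↦ (b i)⁻¹ * x) ⁻¹' U ∈ 𝓝 (1 : G) :=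
      (continuous_const_mul ((b i)⁻¹)).continuousAt.preimage_mem_nhds (by simpa using hU)
    obtain ⟨w, hw, hwU⟩ := h _ hU'
    refine ⟨_, hwU, hmono _ ?_⟩
    have hbM (k : ι) : b k ∈ Submonoid.closure (range b) :=
      Submonoid.subset_closure (mem_range_self k)
    change (b i)⁻¹ * ∏ k, b k ^ w k ∈ _
    -- The factor `b i` occurs at least once, so dividing by it leaves a product of generators.
    rw [← Finset.mul_prod_erase _ _ (Finset.mem_univ i), ← mul_assoc,
      ← Nat.succ_pred_eq_of_ne_zero (hw i), pow_succ', inv_mul_cancel_left]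
    exact mul_mem (pow_mem (hbM i) _) (prod_mem fun k _ ↦ pow_mem (hbM k) _)
  have hTtop (x : G) (hx : x ∈ Subgroup.closure (range b)) : x ∈ closure (S : Set G) := by
    change x ∈ T
    induction hx using Subgroup.closure_induction'' with
    | mem x hx => exact S.le_topologicalClosure (Subsemigroup.subset_closure hx)
    | inv_mem x hx => obtain ⟨i, rfl⟩ := hx; exact hinv i
    | one => exact h1
    | mul x y _ _ hx hy => exact mul_mem hx hy
  exact dense_closure.1 (hd.mono hTtop)

/-- The homomorphism `ℤ ^ ι → G` given by generators of a dense subgroup takes nonzero vectors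
into each neighbourhood of `1`: otherwise `{1}` would be open, and then `G` is finite. -/
theorem exists_ne_zero_prod_zpow_mem [T1Space G] [IsTopologicalGroup G] [Fintype ι] [Nonempty ι]
    (hfin : DiscreteTopology G → Finite G) {a : ι → G}
    (hd : Dense (Subgroup.closure (range a) : Set G)) {U : Set G} (hU : U ∈ 𝓝 (1 : G)) :
    ∃ v : ι → ℤ, v ≠ 0 ∧ ∏ i, a i ^ v i ∈ U := by
  classical
  by_contra! hcon
  have hsub : interior U ∩ Subgroup.closure (range a) ⊆ {1} := by
    rintro x ⟨hxU, hx⟩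
    obtain ⟨v, rfl⟩ := Subgroup.exists_of_mem_closure_range _ _ hx
    by_cases hv : v = 0
    · simp [hv]
    · exact absurd (interior_subset hxU) (hcon v hv)
  have hint : interior U = {1} := by
    refine Subset.antisymm ?_ (singleton_subset_iff.2 (mem_interior_iff_mem_nhds.2 hU))
    calc interior U ⊆ closure (interior U ∩ Subgroup.closure (range a)) :=
          hd.open_subset_closure_inter isOpen_interior
      _ ⊆ closure {1} := closure_mono hsub
      _ = {1} := closure_singleton
  have hdisc : DiscreteTopology G :=
    discreteTopology_of_isOpen_singleton_one (hint ▸ isOpen_interior)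
  have := hfin hdisc
  obtain ⟨i⟩ := ‹Nonempty ι›
  -- In a finite group a multiple of a unit vector is a nonzero relation.
  refine hcon (Pi.single i (orderOf (a i) : ℤ)) ?_ ?_
  · simpa using (orderOf_pos (a i)).ne'
  · rw [Fintype.prod_eq_single i fun k hk ↦ by rw [Pi.single_eq_of_ne hk, zpow_zero]]
    simpa [pow_orderOf_eq_one] using mem_of_mem_nhds hU

theorem HasDenseSubgroup.hasDenseSubsemigroup [T1Space G] [IsTopologicalGroup G]
    (hfin : DiscreteTopology G → Finite G) {t : ℕ} (ht : t ≠ 0) (h : HasDenseSubgroup G t) :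
    HasDenseSubsemigroup G t := by
  obtain ⟨a, ha⟩ := h
  have : NeZero t := ⟨ht⟩
  obtain ⟨b, hb, hpos⟩ := exists_closure_range_eq_and_forall_pos a
    fun U hU ↦ exists_ne_zero_prod_zpow_mem hfin ha hU
  exact ⟨b, dense_subsemigroup_closure_range (hb ▸ ha) hpos⟩

end PositiveGenerators

end DenseGenerators

/-! ### Generators of an abelian Lie group and of its identity component -/

theorem mainTheorem6
    {E : Type*} [NormedAddCommGroup E] [NormedSpace ℝ E] [FiniteDimensional ℝ E]
    {H : Type*} [TopologicalSpace H] (I : ModelWithCorners ℝ E H) [I.Boundaryless]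
    (G : Type*) [CommGroup G] [TopologicalSpace G] [IsTopologicalGroup G]
    [ChartedSpace H G] [LieGroup I ∞ G]
    [Finite (G ⧸ Subgroup.connectedComponentOfOne G)] :
    -- a dense sub(semi)group of `G` with `t` generators yields one of `G⁰`
    ((∀ t : ℕ, HasDenseSubgroup G t →
        HasDenseSubgroup (Subgroup.connectedComponentOfOne G) t) ∧
      (∀ t : ℕ, HasDenseSubsemigroup G t →
        HasDenseSubsemigroup (Subgroup.connectedComponentOfOne G) t)) ∧
    -- conversely, together with `t₁` generators of the component group
    ((∀ t₀ t₁ : ℕ, HasDenseSubgroup (Subgroup.connectedComponentOfOne G) t₀ →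
        GeneratedBy (G ⧸ Subgroup.connectedComponentOfOne G) t₁ →
        HasDenseSubgroup G (max t₀ t₁)) ∧
      (∀ t₀ t₁ : ℕ, HasDenseSubsemigroup (Subgroup.connectedComponentOfOne G) t₀ →
        GeneratedBy (G ⧸ Subgroup.connectedComponentOfOne G) t₁ →
        HasDenseSubsemigroup G (max t₀ t₁))) ∧
    -- the formula for the minimal numbers of topological generators
    (Nontrivial G → dGr G = dM G) ∧
    dM G = max (dM (Subgroup.connectedComponentOfOne G))
      (dM (G ⧸ Subgroup.connectedComponentOfOne G)) ∧
    dGr G = max (dGr (Subgroup.connectedComponentOfOne G))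
      (dGr (G ⧸ Subgroup.connectedComponentOfOne G)) := by
  have : CompleteSpace E := FiniteDimensional.complete ℝ E
  have : T1Space G := I.t1Space G
  have hdisc : DiscreteTopology (G ⧸ Subgroup.connectedComponentOfOne G) :=
    QuotientGroup.discreteTopology (isOpen_connectedComponentOfOne I G)
  set N := Subgroup.connectedComponentOfOne G
  have hdiv : ∀ x ∈ N, ∃ y ∈ N, y ^ N.index = x := fun x hx ↦
    exists_pow_eq_of_mem_connectedComponentOfOne I Subgroup.index_ne_zero_of_finite hx
  have hsurj := Subgroup.powIndexHom_surjective hdiv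
  have hgr (t : ℕ) (h : HasDenseSubgroup G t) : HasDenseSubgroup N t :=
    h.map _ N.continuous_powIndexHom hsurj
  have hm (t : ℕ) (h : HasDenseSubsemigroup G t) : HasDenseSubsemigroup N t :=
    h.map _ N.continuous_powIndexHom hsurj
  have hmk : Continuous (QuotientGroup.mk' N) := continuous_quot_mk
  refine ⟨⟨hgr, hm⟩, ⟨fun t₀ t₁ h₀ h₁ ↦ h₀.of_quotient hdiv h₁,
    fun t₀ t₁ h₀ h₁ ↦ h₀.of_quotient hdiv h₁⟩, fun hG ↦ ?_, ?_, ?_⟩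
  all_goals refine ENat.eq_of_forall_le_natCast_iff fun t ↦ ?_
  · rw [dGr_le_iff, dM_le_iff]
    exact ⟨fun h ↦ h.hasDenseSubsemigroup
      (fun _ ↦ finite_of_discreteTopology_of_finite_quotient) h.ne_zero,
      fun h ↦ h.hasDenseSubgroup⟩
  · rw [max_le_iff, dM_le_iff, dM_le_iff, dM_le_iff]
    refine ⟨fun h ↦ ⟨hm t h, h.map _ hmk (QuotientGroup.mk'_surjective N)⟩, fun ⟨h₀, h₁⟩ ↦ ?_⟩
    simpa using h₀.of_quotient hdiv (generatedBy_iff_hasDenseSubgroup.2 h₁.hasDenseSubgroup)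
  · rw [max_le_iff, dGr_le_iff, dGr_le_iff, dGr_le_iff]
    refine ⟨fun h ↦ ⟨hgr t h, h.map _ hmk (QuotientGroup.mk'_surjective N)⟩, fun ⟨h₀, h₁⟩ ↦ ?_⟩
    simpa using h₀.of_quotient hdiv (generatedBy_iff_hasDenseSubgroup.2 h₁)
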